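/- Conventions. All graphs are finite and simple, and $\log$ is base $2$. For a graph $G$, a vertex $u$ and a real $\rho\ge 0$, the radius-$\rho$ ball around $u$ is the set of vertices at distance at most $\rho$ from $u$ in $G$ (vertices in different components are at distance $+\infty$). A set $A\subseteq V(G)$ is $(\ell,\rho)$-coverable, for reals $\ell,\rho\ge 0$, if $A$ is contained in the union of at most $\ell$ radius-$\rho$ balls of $G$. For $\mu\colon V(G)\to\mathbb{R}_{\ge 0}$, a set $X\subseteq V(G)$ is a balanced separator for $\mu$ if every connected component $C$ of $G-X$ satisfies $\mu(C)\le\frac12\mu(V(G))$, where $\mu(A)=\sum_{v\in A}\mu(v)$. The distance-$r$ balanced separator number of $G$ is the smallest $k\in\mathbb{N}$ such that every $\mu\colon V(G)\to\mathbb{R}_{\ge 0}$ has a $(k,r)$-coverable balanced separator. A tree decomposition of $G$ is a finite tree $T$ together with a set $\mathsf{bag}(x)\subseteq V(G)$ for every node $x$ of $T$, such that both ends of every edge of $G$ lie in a common bag, and for every vertex $v$ of $G$ the nodes $x$ with $v\in\mathsf{bag}(x)$ induce a non-empty connected subtree of $T$. Theorem 1.4. There is a constant $c\in\mathbb{N}$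 such that the following holds. Let $r\ge 1$, $k\ge 2$ and $n\ge 2$ be integers, and let $G$ be an $n$-vertex graph whose distance-$r$ balanced separator number is at most $k$. Then $G$ has a tree decomposition whose every bag is $(c\,k^2\log k,\; r(\log k+\log\log n+c))$-coverable. -/

import Mathlib

open scoped NNReal

universe u w

namespace CoarseGraph

variable {V : Type u}

/-- The closed ball of real radius `ρ` around `u`: the vertices at distance at most `ρ` from `u`,
where vertices in different components are at infinite distance. -/
def closedBall (G : SimpleGraph V) (u : V) (ρ : ℝ) : Set V :=
  {v | G.Reachable u v ∧ (G.dist u v : ℝ) ≤ ρ}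

/-- `A` is `(k, ρ)`-coverable: it is contained in the union of at most `k` balls of radius `ρ`
of `G`. Both parameters are allowed to be real numbers. -/
def Coverable (G : SimpleGraph V) (k ρ : ℝ) (A : Set V) : Prop :=
  ∃ F : Finset V, (F.card : ℝ) ≤ k ∧ A ⊆ ⋃ u ∈ F, closedBall G u ρ

/-- The total weight of a set of vertices. -/
noncomputable def weight [Fintype V] (μ : V → ℝ≥0) (A : Set V) : ℝ≥0 :=
  ∑ v, A.indicator μ v

/-- `X` is a balanced separator of `G` for `μ`: every connected component of `G - X` has weight at
most half of the total weight. -/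
def IsBalancedSeparator [Fintype V] (G : SimpleGraph V) (μ : V → ℝ≥0) (X : Set V) : Prop :=
  ∀ C : (G.induce Xᶜ).ConnectedComponent,
    weight μ (Subtype.val '' C.supp) ≤ weight μ Set.univ / 2

/-- Every weight function admits a `(k, r)`-coverable balanced separator. -/
def HasCoverableSeparators [Fintype V] (G : SimpleGraph V) (r : ℝ) (k : ℕ) : Prop :=
  ∀ μ : V → ℝ≥0, ∃ X : Set V, Coverable G k r X ∧ IsBalancedSeparator G μ X

/-- The distance-`r` balanced separator number (for `0 ≤ r`): the smallest `k` such that every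
weight function admits a `(k, r)`-coverable balanced separator. -/
noncomputable def balancedSeparatorNumber [Fintype V] (G : SimpleGraph V) (r : ℝ) : ℕ :=
  sInf {k : ℕ | HasCoverableSeparators G r k}

theorem hasCoverableSeparators_card [Fintype V] (G : SimpleGraph V) {r : ℝ} (hr : 0 ≤ r) :
    HasCoverableSeparators G r (Fintype.card V) := by
  intro μ
  refine ⟨Set.univ, ⟨Finset.univ, by simp, ?_⟩, ?_⟩
  · intro v _
    simp only [Set.mem_iUnion]
    exact ⟨v, Finset.mem_univ v, SimpleGraph.Reachable.refl v, by simpa using hr⟩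
  · intro C
    induction C using SimpleGraph.ConnectedComponent.ind with
    | _ v => exact absurd (Set.mem_univ _) v.2

theorem HasCoverableSeparators.mono [Fintype V] {G : SimpleGraph V} {r : ℝ} {k l : ℕ}
    (h : HasCoverableSeparators G r k) (hkl : k ≤ l) : HasCoverableSeparators G r l := by
  intro μ
  obtain ⟨X, ⟨F, hF, hX⟩, hb⟩ := h μ
  exact ⟨X, ⟨F, hF.trans (by exact_mod_cast hkl), hX⟩, hb⟩

/-- The infimum defining the balanced separator number is attained. -/
theorem balancedSeparatorNumber_le_iff [Fintype V] (G : SimpleGraph V) {r : ℝ} (hr : 0 ≤ r)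
    (k : ℕ) : balancedSeparatorNumber G r ≤ k ↔ HasCoverableSeparators G r k := by
  constructor
  · intro h
    have hne : {k : ℕ | HasCoverableSeparators G r k}.Nonempty :=
      ⟨_, hasCoverableSeparators_card G hr⟩
    exact HasCoverableSeparators.mono (Nat.sInf_mem hne) h
  · exact fun h => Nat.sInf_le h

/-- A tree decomposition of `G` with set of nodes `N`. -/
structure TreeDecomposition (G : SimpleGraph V) (N : Type w) where
  /-- The underlying tree. -/
  tree : SimpleGraph N
  isTree : tree.IsTree
  /-- The bag of each node. -/
  bag : N → Set V
  exists_bag_of_adj : ∀ u v : V, G.Adj u v → ∃ x : N, u ∈ bag x ∧ v ∈ bag x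
  /-- `Connected` includes non-emptiness. -/
  connected : ∀ v : V, (tree.induce {x : N | v ∈ bag x}).Connected

end CoarseGraph

/-! Split `G` recursively. A piece `W` carries a family of balls covering its outer boundary; a ball
is a pair (centre, level), of radius r·level. One separator `X₁` halves the ball centres, another,
`X₂`, halves `W`. The bag is the boundary together with `W ∩ (X₁ ∪ X₂)`, and the components of the
rest of `W` are the children. Halving `W` keeps the depth logarithmic in n.

The difficulty is to keep the families small without radii growing linearly in the depth. A
component of `G - X₁` contains at most half of the centres, and a ball centred elsewhere reaches it
only through `X₁`. If its centre is far from the k centres covering `X₁`, its trace lies in a ball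
around one of those, with level lowered by s - 2 (`mem_catching_ball`). The balls centred near one
of those k centres are merged into boundedly many (`exists_small_family`). The potential ∑ 2^level
controls both replacements: with 4k ≤ 2^s, `exists_family_of_component` adds at most k to it.

Thus the potential stays O(k log n), which bounds every level by log k + log log n + O(1), while a
bag needs O(k·s·2^s) = O(k² log k) balls. -/

namespace CoarseGraph

variable {V : Type u}

/-! ### Rooted decompositions and their gluing. -/

/-- A rooted tree decomposition of the part of `G` spanned by `W` and its boundary `S`, the tree
being given by a parent function. The boundary lies in the root bag. -/
structure RootedDecomposition (G : SimpleGraph V) (W S : Set V) (N : Type w) where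
  parent : N → N
  depth : N → ℕ
  root : N
  bag : N → Set V
  parent_root : parent root = root
  depth_parent_lt : ∀ x, x ≠ root → depth (parent x) < depth x
  bag_subset : ∀ x, bag x ⊆ W ∪ S
  boundary_subset : S ⊆ bag root
  exists_bag_of_adj : ∀ u ∈ W, ∀ v, G.Adj u v → ∃ x, u ∈ bag x ∧ v ∈ bag x
  mem_parent_of_boundary : ∀ v ∈ S, ∀ x, x ≠ root → v ∈ bag x → v ∈ bag (parent x)
  exists_top : ∀ v ∈ W, ∃ t, v ∈ bag t ∧
    ∀ x, v ∈ bag x → x ≠ t → x ≠ root ∧ v ∈ bag (parent x)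

/-- The graph joining every element to its parent. -/
def parentGraph {N : Type w} (parent : N → N) : SimpleGraph N :=
  SimpleGraph.fromRel fun x y => parent x = y

theorem parentGraph_adj_parent {N : Type w} {parent : N → N} {x : N} (h : x ≠ parent x) :
    (parentGraph parent).Adj x (parent x) :=
  (SimpleGraph.fromRel_adj _ _ _).2 ⟨h, Or.inl rfl⟩

/-- Connected because depth drops towards the root; acyclic by counting, since each edge comes from
a non-root node. -/
theorem parentGraph_isTree {N : Type w} [Finite N] (parent : N → N) (depth : N → ℕ) (root : N)
    (hroot : parent root = root) (hlt : ∀ x, x ≠ root → depth (parent x) < depth x) :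
    (parentGraph parent).IsTree := by
  classical
  have hadj : ∀ x, x ≠ root → (parentGraph parent).Adj x (parent x) := fun x hx =>
    parentGraph_adj_parent fun h => by have := hlt x hx; rw [← h] at this; omega
  have hreach : ∀ d x, depth x = d → (parentGraph parent).Reachable x root := by
    intro d
    induction d using Nat.strong_induction_on with
    | _ d ih =>
      intro x hx
      by_cases h : x = root
      · rw [h]
      · exact (hadj x h).reachable.trans (ih _ (hx ▸ hlt x h) _ rfl)
  have hconn : (parentGraph parent).Connected := by
    have : Nonempty N := ⟨root⟩
    exact ⟨fun x y => (hreach _ x rfl).trans (hreach _ y rfl).symm⟩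
  refine (SimpleGraph.isTree_iff_connected_and_card).2 ⟨hconn, le_antisymm ?_ ?_⟩
  · have hsub : (parentGraph parent).edgeSet ⊆
        (fun x => s(x, parent x)) '' ({root}ᶜ : Set N) := by
      intro e
      induction e using Sym2.ind with
      | _ x y =>
        intro he
        obtain ⟨hne, h | h⟩ := (SimpleGraph.fromRel_adj _ _ _).1 ((SimpleGraph.mem_edgeSet _).1 he)
        · exact ⟨x, fun hx => hne (by rw [← h, Set.mem_singleton_iff.1 hx, hroot]), by simp [h]⟩
        · exact ⟨y, fun hx => hne (by rw [← h, Set.mem_singleton_iff.1 hx, hroot]),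
            by simp [h, Sym2.eq_swap]⟩
    have h1 := (Set.ncard_le_ncard hsub (Set.toFinite _)).trans (Set.ncard_image_le (Set.toFinite _))
    have h2 := Set.ncard_add_ncard_compl ({root} : Set N)
    rw [Set.ncard_singleton] at h2
    rw [Nat.card_coe_set_eq]
    omega
  · exact hconn.card_vert_le_card_edgeSet_add_one

namespace RootedDecomposition

variable {G : SimpleGraph V}

/-- A rooted decomposition of the whole graph is a tree decomposition. -/
def toTreeDecomposition {W S : Set V} {N : Type w} [Finite N] (T : RootedDecomposition G W S N)
    (hW : ∀ v, v ∈ W) : TreeDecomposition G N where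
  tree := parentGraph T.parent
  isTree := parentGraph_isTree T.parent T.depth T.root T.parent_root T.depth_parent_lt
  bag := T.bag
  exists_bag_of_adj u v h := T.exists_bag_of_adj u (hW u) v h
  connected v := by
    obtain ⟨t, ht, h⟩ := T.exists_top v (hW v)
    have key : ∀ d x, T.depth x = d → ∀ hx : v ∈ T.bag x,
        ((parentGraph T.parent).induce {x | v ∈ T.bag x}).Reachable ⟨x, hx⟩ ⟨t, ht⟩ := by
      intro d
      induction d using Nat.strong_induction_on with
      | _ d ih =>
        intro x hd hx
        by_cases hxt : x = t
        · subst hxt; exact SimpleGraph.Reachable.refl _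
        · obtain ⟨hr, hp⟩ := h x hx hxt
          have hlt := T.depth_parent_lt x hr
          have hadj : ((parentGraph T.parent).induce {x | v ∈ T.bag x}).Adj ⟨x, hx⟩
              ⟨T.parent x, hp⟩ := by
            refine SimpleGraph.induce_adj.2 (parentGraph_adj_parent fun e => ?_)
            rw [← e] at hlt
            exact lt_irrefl _ hlt
          exact hadj.reachable.trans (ih _ (hd ▸ hlt) _ rfl hp)
    have : Nonempty {x | v ∈ T.bag x} := ⟨⟨t, ht⟩⟩
    exact ⟨fun x y => (key _ x.1 rfl x.2).trans (key _ y.1 rfl y.2).symm⟩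

/-- The decomposition with a single bag, for an empty interior. -/
def single (G : SimpleGraph V) (S : Set V) : RootedDecomposition G ∅ S PUnit.{w + 1} where
  parent := id
  depth _ := 0
  root := PUnit.unit
  bag _ := S
  parent_root := rfl
  depth_parent_lt _ hx := absurd rfl hx
  bag_subset _ := Set.subset_union_right
  boundary_subset := subset_rfl
  exists_bag_of_adj _ hu := hu.elim
  mem_parent_of_boundary _ _ _ _ h := h
  exists_top _ hv := hv.elim

open Classical in
/-- Attaching decompositions of pairwise non-adjacent pieces `W' i` of `W \ X` below a root with
bag `S ∪ X`. -/
noncomputable def glue {W S X : Set V} {ι : Type u} {N : ι → Type u} {W' S' : ι → Set V}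
    (T : ∀ i, RootedDecomposition G (W' i) (S' i) (N i))
    (hXW : X ⊆ W) (hWS : Disjoint W S)
    (hcover : W \ X = ⋃ i, W' i) (hdisj : ∀ i j v, v ∈ W' i → v ∈ W' j → i = j)
    (hS : ∀ u ∈ W, ∀ v, G.Adj u v → v ∈ W ∪ S)
    (hS' : ∀ i, S' i ⊆ S ∪ X) :
    RootedDecomposition G W S (Option (Σ i, N i)) :=
  have hW' : ∀ i, W' i ⊆ W \ X := fun i => hcover ▸ Set.subset_iUnion W' i
  have hnot : ∀ i v, v ∈ W' i → v ∉ S ∪ X := fun i v hv h => h.elim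
    (fun h => Set.disjoint_left.1 hWS (hW' i hv).1 h) (hW' i hv).2
  { parent := fun x => match x with
      | none => none
      | some ⟨i, x⟩ => if x = (T i).root then none else some ⟨i, (T i).parent x⟩
    depth := fun x => match x with
      | none => 0
      | some ⟨i, x⟩ => (T i).depth x + 1
    root := none
    bag := fun x => match x with
      | none => S ∪ X
      | some ⟨i, x⟩ => (T i).bag x
    parent_root := rfl
    depth_parent_lt := by
      rintro (_ | ⟨i, x⟩) hx
      · exact absurd rfl hx
      · by_cases h : x = (T i).root
        · simp [h]
        · simpa [h] using (T i).depth_parent_lt x h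
    bag_subset := by
      rintro (_ | ⟨i, x⟩) v hv
      · exact hv.elim Or.inr fun h => Or.inl (hXW h)
      · rcases (T i).bag_subset x hv with h | h
        · exact Or.inl (hW' i h).1
        · exact (hS' i h).elim Or.inr fun h => Or.inl (hXW h)
    boundary_subset := Set.subset_union_left
    exists_bag_of_adj := by
      have main : ∀ i, ∀ u ∈ W' i, ∀ v, G.Adj u v → ∃ x : Option (Σ i, N i),
          u ∈ (match x with | none => S ∪ X | some ⟨i, x⟩ => (T i).bag x : Set V) ∧
          v ∈ (match x with | none => S ∪ X | some ⟨i, x⟩ => (T i).bag x : Set V) := by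
        intro i u hu v huv
        obtain ⟨x, hx⟩ := (T i).exists_bag_of_adj u hu v huv
        exact ⟨some ⟨i, x⟩, hx⟩
      have split : ∀ u ∈ W, u ∈ X ∨ ∃ i, u ∈ W' i := by
        intro u hu
        by_cases h : u ∈ X
        · exact Or.inl h
        · exact Or.inr (Set.mem_iUnion.1 (hcover.subset ⟨hu, h⟩))
      intro u hu v huv
      rcases split u hu with h | ⟨i, hi⟩
      · rcases hS u hu v huv with hv | hv
        · rcases split v hv with h' | ⟨j, hj⟩
          · exact ⟨none, Or.inr h, Or.inr h'⟩
          · obtain ⟨x, h1, h2⟩ := main j v hj u huv.symm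
            exact ⟨x, h2, h1⟩
        · exact ⟨none, Or.inr h, Or.inl hv⟩
      · exact main i u hi v huv
    -- A vertex of `S` is never interior to a child, so inside a child it is a boundary vertex and
    -- climbs to the child's root.
    mem_parent_of_boundary := by
      rintro v hv (_ | ⟨i, x⟩) hx hvx
      · exact absurd rfl hx
      · by_cases h : x = (T i).root
        · simp only [h, if_true]
          exact Or.inl hv
        · simp only [h, if_false]
          refine (T i).mem_parent_of_boundary v ?_ x h hvx
          exact ((T i).bag_subset x hvx).resolve_left fun h' => hnot i v h' (Or.inl hv)
    exists_top := by
      intro v hv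
      by_cases hX : v ∈ X
      · refine ⟨none, Or.inr hX, ?_⟩
        rintro (_ | ⟨i, x⟩) hvx hx
        · exact absurd rfl hx
        · refine ⟨hx, ?_⟩
          by_cases h : x = (T i).root
          · simp only [h, if_true]
            exact Or.inr hX
          · simp only [h, if_false]
            refine (T i).mem_parent_of_boundary v ?_ x h hvx
            exact ((T i).bag_subset x hvx).resolve_left fun h' => hnot i v h' (Or.inr hX)
      · obtain ⟨i, hi⟩ := Set.mem_iUnion.1 (hcover.subset ⟨hv, hX⟩)
        obtain ⟨t, ht, htop⟩ := (T i).exists_top v hi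
        refine ⟨some ⟨i, t⟩, ht, ?_⟩
        rintro (_ | ⟨j, x⟩) hvx hx
        · exact absurd hvx (hnot i v hi)
        · have hj : v ∈ W' j := ((T j).bag_subset x hvx).resolve_right
            fun h => hnot i v hi (hS' j h)
          obtain rfl := hdisj i j v hi hj
          obtain ⟨hr, hp⟩ := htop x hvx (fun h => hx (by rw [h]))
          refine ⟨Option.some_ne_none _, ?_⟩
          simpa only [hr, if_false] using hp }

end RootedDecomposition

/-! ### Scaled balls and their potential. -/

/-- The ball of radius `r * p.2` around `p.1`. -/
def scaledBall (G : SimpleGraph V) (r : ℕ) (p : V × ℕ) : Set V :=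
  {v | G.Reachable p.1 v ∧ G.dist p.1 v ≤ r * p.2}

/-- The union of a finite family of scaled balls. -/
def scaledUnion (G : SimpleGraph V) (r : ℕ) (U : Finset (V × ℕ)) : Set V :=
  ⋃ p ∈ U, scaledBall G r p

/-- The potential of a finite family of scaled balls. -/
def potential (U : Finset (V × ℕ)) : ℕ := ∑ p ∈ U, 2 ^ p.2

theorem mem_scaledUnion {G : SimpleGraph V} {r : ℕ} {U : Finset (V × ℕ)} {v : V} :
    v ∈ scaledUnion G r U ↔ ∃ p ∈ U, v ∈ scaledBall G r p := by
  simp [scaledUnion]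

theorem scaledUnion_mono {G : SimpleGraph V} {r : ℕ} {U U' : Finset (V × ℕ)} (h : U ⊆ U') :
    scaledUnion G r U ⊆ scaledUnion G r U' :=
  Set.biUnion_subset_biUnion_left h

theorem potential_mono {U U' : Finset (V × ℕ)} (h : U ⊆ U') : potential U ≤ potential U' :=
  Finset.sum_le_sum_of_subset h

theorem potential_union_le [DecidableEq V] (U U' : Finset (V × ℕ)) :
    potential (U ∪ U') ≤ potential U + potential U' := by
  unfold potential
  rw [← Finset.sum_union_inter]
  exact Nat.le_add_right _ _

theorem potential_biUnion_le [DecidableEq V] {ι : Type*} (F : Finset ι)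
    (U : ι → Finset (V × ℕ)) : potential (F.biUnion U) ≤ ∑ i ∈ F, potential (U i) := by
  classical
  induction F using Finset.induction_on with
  | empty => simp [potential]
  | insert a F ha ih =>
    rw [Finset.biUnion_insert, Finset.sum_insert ha]
    exact (potential_union_le _ _).trans (Nat.add_le_add_left ih _)

theorem potential_product_singleton (F : Finset V) (l : ℕ) :
    potential (F ×ˢ {l}) = F.card * 2 ^ l := by
  simp [potential]

theorem two_pow_le_potential {U : Finset (V × ℕ)} {p : V × ℕ} (hp : p ∈ U) :
    2 ^ p.2 ≤ potential U :=
  Finset.single_le_sum (f := fun p : V × ℕ => 2 ^ p.2) (fun _ _ => Nat.zero_le _) hp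

/-- One reachability hypothesis suffices: if `c` is out of reach from `b`, it is out of reach from
`a`, and the left side is 0 by convention. -/
theorem dist_triangle {G : SimpleGraph V} {a b c : V} (h : G.Reachable a b) :
    G.dist a c ≤ G.dist a b + G.dist b c := by
  by_cases hbc : G.Reachable b c
  · obtain ⟨p, hp⟩ := h.exists_walk_length_eq_dist
    obtain ⟨q, hq⟩ := hbc.exists_walk_length_eq_dist
    rw [← hp, ← hq, ← SimpleGraph.Walk.length_append]
    exact SimpleGraph.dist_le _
  · have : ¬ G.Reachable a c := fun hac => hbc (h.symm.trans hac)
    rw [SimpleGraph.dist_eq_zero_of_not_reachable this]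
    exact Nat.zero_le _

theorem scaledBall_subset {G : SimpleGraph V} {r l l' s : ℕ} {a b : V}
    (h : b ∈ scaledBall G r (a, s)) (hl : l + s ≤ l') :
    scaledBall G r (b, l) ⊆ scaledBall G r (a, l') := by
  rintro v ⟨hv, hd⟩
  refine ⟨h.1.trans hv, (dist_triangle h.1).trans ?_⟩
  calc G.dist a b + G.dist b v ≤ r * s + r * l := Nat.add_le_add h.2 hd
    _ = r * (l + s) := by ring
    _ ≤ r * l' := Nat.mul_le_mul_left _ hl

theorem scaledBall_symm {G : SimpleGraph V} {r s : ℕ} {a b : V}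
    (h : b ∈ scaledBall G r (a, s)) : a ∈ scaledBall G r (b, s) :=
  ⟨h.1.symm, by rw [SimpleGraph.dist_comm]; exact h.2⟩

/-- A family of scaled balls whose centres are all close to `x` can be replaced by a small family
of no larger potential. -/
theorem exists_small_family (G : SimpleGraph V) (r s : ℕ) (hs : 1 ≤ s) (x : V)
    (U : Finset (V × ℕ)) (hU : ∀ p ∈ U, p.1 ∈ scaledBall G r (x, s)) :
    ∃ U' : Finset (V × ℕ), scaledUnion G r U ⊆ scaledUnion G r U' ∧
      potential U' ≤ potential U ∧ U'.card ≤ 2 * s * 2 ^ s := by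
  classical
  -- A family of least cardinality with these properties works.
  let Q : Finset (V × ℕ) → Prop := fun U' => (∀ p ∈ U', p.1 ∈ scaledBall G r (x, s)) ∧
    scaledUnion G r U ⊆ scaledUnion G r U' ∧ potential U' ≤ potential U
  have hex : ∃ m, ∃ U', Q U' ∧ U'.card = m := ⟨_, U, ⟨hU, subset_rfl, le_rfl⟩, rfl⟩
  obtain ⟨A, ⟨hA, hcov, hpot⟩, hcard⟩ := Nat.find_spec hex
  have hmin : ∀ B, Q B → A.card ≤ B.card := fun B hB => by
    rw [hcard]; exact Nat.find_min' hex ⟨B, hB, rfl⟩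
  refine ⟨A, hcov, hpot, ?_⟩
  rcases A.eq_empty_or_nonempty with rfl | hne
  · simp
  obtain ⟨q, hq, hqmax⟩ := A.exists_max_image (fun p => p.2) hne
  -- Centres are within 2rs of each other, so a ball at least 2s levels below the top one lies
  -- inside it and could be dropped.
  have hlevel : ∀ p ∈ A, q.2 < p.2 + 2 * s := by
    intro p hp
    by_contra hcon
    have hpq : q ≠ p := by rintro rfl; omega
    have hle : A.card ≤ (A.erase p).card := by
      refine hmin _ ⟨fun p' hp' => hA p' (Finset.mem_of_mem_erase hp'), ?_,
        (potential_mono (Finset.erase_subset _ _)).trans hpot⟩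
      intro v hv
      obtain ⟨p', hp', hv'⟩ := mem_scaledUnion.1 (hcov hv)
      by_cases h : p' = p
      · subst h
        refine mem_scaledUnion.2 ⟨q, Finset.mem_erase.2 ⟨hpq, hq⟩, ?_⟩
        have h1 := scaledBall_subset (l' := p'.2 + s) (hA p' hp') le_rfl hv'
        exact scaledBall_subset (scaledBall_symm (hA q hq)) (by omega) h1
      · exact mem_scaledUnion.2 ⟨p', Finset.mem_erase.2 ⟨h, hp'⟩, hv'⟩
    rw [Finset.card_erase_of_mem hp] at hle
    have := Finset.card_pos.2 hne
    omega
  -- More than 2^s balls of level m could be traded for the single ball `(x, m + s)`, which contains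
  -- them all and has potential only 2^s·2^m.
  have hfiber : ∀ m, (A.filter fun p => p.2 = m).card ≤ 2 ^ s := by
    intro m
    by_contra hcon
    rw [not_le] at hcon
    set B := A.filter fun p => p.2 ≠ m with hB
    have hsplit : (A.filter fun p => p.2 = m).card + B.card = A.card :=
      Finset.card_filter_add_card_filter_not _
    have hpotB : potential (A.filter fun p => p.2 = m) + potential B = potential A :=
      Finset.sum_filter_add_sum_filter_not _ _ _
    have hpotm : potential (A.filter fun p => p.2 = m) =
        (A.filter fun p => p.2 = m).card * 2 ^ m := by
      unfold potential
      rw [Finset.sum_congr rfl (g := fun _ => 2 ^ m), Finset.sum_const, smul_eq_mul]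
      intro p hp
      rw [(Finset.mem_filter.1 hp).2]
    have hle : A.card ≤ (insert (x, m + s) B).card := by
      refine hmin _ ⟨?_, ?_, ?_⟩
      · intro p hp
        rcases Finset.mem_insert.1 hp with rfl | hp
        · exact ⟨SimpleGraph.Reachable.refl _, by simp⟩
        · exact hA p (Finset.mem_filter.1 hp).1
      · intro v hv
        obtain ⟨p, hp, hv'⟩ := mem_scaledUnion.1 (hcov hv)
        by_cases h : p.2 = m
        · refine mem_scaledUnion.2 ⟨_, Finset.mem_insert_self _ _, ?_⟩
          exact scaledBall_subset (hA p hp) (by rw [h]) hv'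
        · exact mem_scaledUnion.2 ⟨p, Finset.mem_insert_of_mem (Finset.mem_filter.2 ⟨hp, h⟩), hv'⟩
      · refine le_trans ?_ hpot
        rw [← hpotB, hpotm, Finset.insert_eq]
        refine (potential_union_le _ _).trans (Nat.add_le_add_right ?_ _)
        have : potential {(x, m + s)} = 2 ^ s * 2 ^ m := by
          simp [potential, pow_add, mul_comm]
        rw [this]
        exact Nat.mul_le_mul_right _ hcon.le
    have := Finset.card_insert_le (x, m + s) B
    have : 1 ≤ 2 ^ s := Nat.one_le_two_pow
    omega
  have hmaps : ∀ p ∈ A, p.2 ∈ Finset.Ico (q.2 + 1 - 2 * s) (q.2 + 1) := by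
    intro p hp
    have h1 := hlevel p hp
    have h2 := hqmax p hp
    simp only [Finset.mem_Ico]
    omega
  refine (Finset.card_le_mul_card_image_of_maps_to hmaps (2 ^ s) fun m _ => hfiber m).trans ?_
  rw [mul_comm, Nat.card_Ico]
  exact Nat.mul_le_mul_right _ (by omega)

/-! ### Components, boundaries and separators. -/

/-- The vertices outside `W` with a neighbour in `W`. -/
def outerBoundary (G : SimpleGraph V) (W : Set V) : Set V := {v | v ∉ W ∧ ∃ u ∈ W, G.Adj u v}

theorem mem_component_of_adj {G : SimpleGraph V} {A : Set V}
    {C : (G.induce A).ConnectedComponent} {u v : V} (hu : u ∈ Subtype.val '' C.supp)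
    (hv : v ∈ A) (huv : G.Adj u v) : v ∈ Subtype.val '' C.supp := by
  obtain ⟨⟨u, hA⟩, hu, rfl⟩ := hu
  have hadj : (G.induce A).Adj ⟨u, hA⟩ ⟨v, hv⟩ := huv
  exact ⟨⟨v, hv⟩, C.mem_supp_of_adj_mem_supp hu hadj, rfl⟩

theorem component_subset_of_subset {G : SimpleGraph V} {A B : Set V} (hAB : A ⊆ B)
    (C : (G.induce A).ConnectedComponent) :
    ∃ C' : (G.induce B).ConnectedComponent, Subtype.val '' C.supp ⊆ Subtype.val '' C'.supp := by
  refine ⟨C.map (SimpleGraph.induceHomOfLE G hAB).toHom, ?_⟩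
  rintro _ ⟨x, hx, rfl⟩
  refine ⟨⟨x.1, hAB x.2⟩, ?_, rfl⟩
  rw [SimpleGraph.ConnectedComponent.mem_supp_iff] at hx ⊢
  rw [← hx]
  rfl

/-- Followed backwards from `v`, the walk can leave the component only through `X`. -/
theorem exists_mem_separator_of_walk {G : SimpleGraph V} {X : Set V}
    {C : (G.induce Xᶜ).ConnectedComponent} {u v : V} (p : G.Walk u v)
    (hu : u ∉ Subtype.val '' C.supp) (hv : v ∈ Subtype.val '' C.supp) :
    ∃ y ∈ X, G.Reachable u y ∧ G.Reachable y v ∧ G.dist u y + G.dist y v ≤ p.length := by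
  induction p with
  | nil => exact absurd hv hu
  | @cons a b c h q ih =>
    by_cases ha : a ∈ X
    · exact ⟨a, ha, SimpleGraph.Reachable.refl _, h.reachable.trans q.reachable,
        by simpa using SimpleGraph.dist_le (SimpleGraph.Walk.cons h q)⟩
    · obtain ⟨y, hy, h1, h2, h3⟩ := ih (fun hb => hu (mem_component_of_adj hb ha h.symm)) hv
      refine ⟨y, hy, h.reachable.trans h1, h2, ?_⟩
      have h4 := dist_triangle (c := y) h.reachable
      rw [SimpleGraph.dist_eq_one_iff_adj.2 h] at h4
      rw [SimpleGraph.Walk.length_cons]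
      omega

-- Points are weighted with multiplicity, since balls of different levels may share a centre.
open Classical in
theorem weight_card_fiber [Fintype V] {α : Type*} (U : Finset α) (f : α → V) (A : Set V) :
    weight (fun v => ((U.filter fun p => f p = v).card : ℝ≥0)) A =
      ((U.filter fun p => f p ∈ A).card : ℝ≥0) := by
  have h1 : ∀ v, (A.indicator (fun v => ((U.filter fun p => f p = v).card : ℝ≥0)) v) =
      (((U.filter fun p => f p ∈ A).filter fun p => f p = v).card : ℝ≥0) := by
    intro v
    rw [Finset.filter_filter]
    by_cases hv : v ∈ A
    · rw [Set.indicator_of_mem hv]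
      congr 2
      ext p
      simp only [Finset.mem_filter]
      exact ⟨fun h => ⟨h.1, h.2 ▸ hv, h.2⟩, fun h => ⟨h.1, h.2.2⟩⟩
    · rw [Set.indicator_of_notMem hv, eq_comm, Nat.cast_eq_zero, Finset.card_eq_zero,
        Finset.filter_eq_empty_iff]
      rintro p - ⟨h, rfl⟩
      exact hv h
  unfold weight
  rw [Finset.sum_congr rfl fun v _ => h1 v, ← Nat.cast_sum]
  congr 1
  exact (Finset.card_eq_sum_card_fiberwise fun _ _ => Finset.mem_univ _).symm

/-- Separators halve any finite family of points. -/
theorem HasCoverableSeparators.exists_halving [Fintype V] {G : SimpleGraph V} {r k : ℕ}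
    (h : HasCoverableSeparators G (r : ℝ) k) {α : Type*} (U : Finset α) (f : α → V) :
    ∃ (X : Set V) (F : Finset V), F.card ≤ k ∧ X ⊆ scaledUnion G r (F ×ˢ {1}) ∧
      ∀ (C : (G.induce Xᶜ).ConnectedComponent) (B : Finset α), B ⊆ U →
        (∀ p ∈ B, f p ∈ Subtype.val '' C.supp) → 2 * B.card ≤ U.card := by
  classical
  obtain ⟨X, ⟨F, hF, hX⟩, hbal⟩ := h fun v => ((U.filter fun p => f p = v).card : ℝ≥0)
  refine ⟨X, F, by exact_mod_cast hF, ?_, ?_⟩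
  · intro v hv
    obtain ⟨x, hx, hr, hd⟩ := Set.mem_iUnion₂.1 (hX hv)
    exact mem_scaledUnion.2 ⟨(x, 1), by simpa using hx, hr, by simpa using mod_cast hd⟩
  · intro C B hB hBC
    have h1 := hbal C
    rw [weight_card_fiber, weight_card_fiber] at h1
    simp only [Set.mem_univ, Finset.filter_true] at h1
    have h2 : B.card ≤ (U.filter fun p => f p ∈ Subtype.val '' C.supp).card :=
      Finset.card_le_card fun p hp => Finset.mem_filter.2 ⟨hB hp, hBC p hp⟩
    have h3 : ((U.filter fun p => f p ∈ Subtype.val '' C.supp).card : ℝ≥0) * 2 ≤ U.card := by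
      rwa [le_div_iff₀ (by norm_num)] at h1
    have h4 : (U.filter fun p => f p ∈ Subtype.val '' C.supp).card * 2 ≤ U.card := by
      exact_mod_cast h3
    omega

/-! ### Transferring ball families to a component. -/

/-- A point of a component of `G - X` in a ball centred outside this component and far from the
centres of `X` is in a smaller ball around one of these centres. -/
theorem mem_catching_ball {G : SimpleGraph V} {r s : ℕ} {X : Set V} {F : Finset V}
    (hX : X ⊆ scaledUnion G r (F ×ˢ {1})) {C : (G.induce Xᶜ).ConnectedComponent} {p : V × ℕ}
    {v : V} (hp : p.1 ∉ Subtype.val '' C.supp) (hv : v ∈ Subtype.val '' C.supp)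
    (hpv : v ∈ scaledBall G r p) (hfar : ∀ x ∈ F, p.1 ∉ scaledBall G r (x, s)) :
    ∃ x ∈ F, v ∈ scaledBall G r (x, p.2 + 2 - s) := by
  obtain ⟨q, hq⟩ := hpv.1.exists_walk_length_eq_dist
  obtain ⟨y, hy, h1, h2, h3⟩ := exists_mem_separator_of_walk q hp hv
  obtain ⟨⟨x, l⟩, hx, hxy, hd⟩ := mem_scaledUnion.1 (hX hy)
  obtain ⟨hx, hl⟩ := Finset.mem_product.1 hx
  obtain rfl : l = 1 := by simpa using hl
  simp only [mul_one] at hx hxy hd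
  refine ⟨x, hx, hxy.trans h2, ?_⟩
  have hpd := hpv.2
  have h4 := hfar x hx
  -- As `y` is within r of `x`, more than rs - r of the path is used up before `y`; going from `x`
  -- to `y` costs at most r more.
  have h5 : r * s < G.dist x p.1 := by
    by_contra hcon
    exact h4 ⟨hxy.trans h1.symm, not_lt.1 hcon⟩
  have h6 := dist_triangle (c := p.1) hxy
  have h7 := dist_triangle (c := v) hxy
  rw [SimpleGraph.dist_comm (u := y) (v := p.1)] at h6
  show G.dist x v ≤ r * (p.2 + 2 - s)
  rw [Nat.mul_sub, Nat.mul_add]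
  omega

/-- Passing to a component of `G - X`, all balls centred outside of it are replaced by few balls,
at the cost of a small increase of the potential. -/
theorem exists_family_of_component {G : SimpleGraph V} {r s k : ℕ} (hs : 2 ≤ s)
    (hks : 4 * k ≤ 2 ^ s) {X : Set V} {F : Finset V} (hF : F.card ≤ k)
    (hX : X ⊆ scaledUnion G r (F ×ˢ {1})) (C : (G.induce Xᶜ).ConnectedComponent) {A : Set V}
    (hAC : A ⊆ Subtype.val '' C.supp) (U : Finset (V × ℕ)) (hAU : A ⊆ scaledUnion G r U) :
    ∃ B ⊆ U, (∀ p ∈ B, p.1 ∈ Subtype.val '' C.supp) ∧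
      ∃ U' : Finset (V × ℕ), A ⊆ scaledUnion G r U' ∧ potential U' ≤ potential U + k ∧
        U'.card ≤ B.card + k + k * (2 * s * 2 ^ s) := by
  classical
  set B := U.filter fun p => p.1 ∈ Subtype.val '' C.supp with hB
  set O := U.filter fun p => p.1 ∉ Subtype.val '' C.supp with hO
  set P := O.filter fun p => ∃ x ∈ F, p.1 ∈ scaledBall G r (x, s) with hP
  set Q := O.filter fun p => ¬ ∃ x ∈ F, p.1 ∈ scaledBall G r (x, s) with hQ
  have hBO : potential B + potential O = potential U := Finset.sum_filter_add_sum_filter_not _ _ _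
  have hPQ : potential P + potential Q = potential O := Finset.sum_filter_add_sum_filter_not _ _ _
  have hg : ∀ p : V × ℕ, ∃ x, p ∈ P → x ∈ F ∧ p.1 ∈ scaledBall G r (x, s) := by
    intro p
    by_cases hp : p ∈ P
    · obtain ⟨x, hx⟩ := (Finset.mem_filter.1 hp).2
      exact ⟨x, fun _ => hx⟩
    · exact ⟨p.1, fun h => absurd h hp⟩
  choose g hg using hg
  have hred : ∀ x, ∃ U' : Finset (V × ℕ),
      scaledUnion G r (P.filter fun p => g p = x) ⊆ scaledUnion G r U' ∧
      potential U' ≤ potential (P.filter fun p => g p = x) ∧ U'.card ≤ 2 * s * 2 ^ s := by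
    intro x
    refine exists_small_family G r s (by omega) x _ fun p hp => ?_
    obtain ⟨h1, rfl⟩ := Finset.mem_filter.1 hp
    exact (hg p h1).2
  choose R hRcov hRpot hRcard using hred
  -- Only the largest level of a far ball matters: one ball of level `L + 2 - s` around each point
  -- of `F` catches all far balls.
  set L := Q.sup Prod.snd with hL
  refine ⟨B, Finset.filter_subset _ _, fun p hp => (Finset.mem_filter.1 hp).2,
    (B ∪ F ×ˢ {L + 2 - s}) ∪ F.biUnion R, ?_, ?_, ?_⟩
  · intro v hv
    obtain ⟨p, hp, hpv⟩ := mem_scaledUnion.1 (hAU hv)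
    by_cases hpC : p.1 ∈ Subtype.val '' C.supp
    · exact mem_scaledUnion.2 ⟨p, Finset.mem_union_left _ (Finset.mem_union_left _
        (Finset.mem_filter.2 ⟨hp, hpC⟩)), hpv⟩
    have hpO : p ∈ O := Finset.mem_filter.2 ⟨hp, hpC⟩
    by_cases hnear : ∃ x ∈ F, p.1 ∈ scaledBall G r (x, s)
    · have hpP : p ∈ P := Finset.mem_filter.2 ⟨hpO, hnear⟩
      have h1 : v ∈ scaledUnion G r (R (g p)) := hRcov (g p)
        (mem_scaledUnion.2 ⟨p, Finset.mem_filter.2 ⟨hpP, rfl⟩, hpv⟩)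
      exact scaledUnion_mono ((Finset.subset_biUnion_of_mem R (hg p hpP).1).trans
        Finset.subset_union_right) h1
    · have hpQ : p ∈ Q := Finset.mem_filter.2 ⟨hpO, hnear⟩
      obtain ⟨x, hx, hxv⟩ := mem_catching_ball (s := s) hX hpC (hAC hv) hpv
        fun x hx h => hnear ⟨x, hx, h⟩
      have hle : p.2 ≤ L := Finset.le_sup (f := Prod.snd) hpQ
      refine mem_scaledUnion.2 ⟨(x, L + 2 - s), Finset.mem_union_left _
        (Finset.mem_union_right _ (by simpa using hx)), hxv.1, hxv.2.trans ?_⟩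
      exact Nat.mul_le_mul_left _ (by simp only; omega)
  · have h1 : potential (F ×ˢ {L + 2 - s}) ≤ k + potential Q := by
      rw [potential_product_singleton]
      refine (Nat.mul_le_mul_right _ hF).trans ?_
      -- If the level truncates to 0, the new balls cost at most k, whence the `+ k`. Otherwise 4k ≤
      -- 2^s bounds their cost by 2^L, paid for by a far ball of level `L`; for empty `Q`, the
      -- default `L = 0` and 2 ≤ s again give level 0.
      rcases Nat.le_total (L + 2) s with h | h
      · simp [Nat.sub_eq_zero_of_le h]
      · have h2 : k * 2 ^ (L + 2 - s) ≤ 2 ^ L := by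
          have h3 : 2 ^ s * 2 ^ (L + 2 - s) = 4 * 2 ^ L := by
            rw [← pow_add, show s + (L + 2 - s) = L + 2 by omega, pow_add]; ring
          have h4 := Nat.mul_le_mul_right (2 ^ (L + 2 - s)) hks
          rw [h3, mul_assoc] at h4
          omega
        rcases Q.eq_empty_or_nonempty with hQe | hQe
        · have hL0 : L = 0 := by rw [hL, hQe]; rfl
          have : L + 2 - s = 0 := by omega
          simp [this]
        · obtain ⟨q, hq, hqL⟩ := Finset.exists_mem_eq_sup Q hQe Prod.snd
          have h5 := two_pow_le_potential hq
          rw [← hqL, ← hL] at h5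
          omega
    have h2 : potential (F.biUnion R) ≤ potential P := by
      refine (potential_biUnion_le _ _).trans ((Finset.sum_le_sum fun x _ => hRpot x).trans ?_)
      exact (Finset.sum_fiberwise_of_maps_to (fun p hp => (hg p hp).1) _).le
    have h3 := potential_union_le (B ∪ F ×ˢ {L + 2 - s}) (F.biUnion R)
    have h4 := potential_union_le B (F ×ˢ {L + 2 - s})
    omega
  · have h1 : (F.biUnion R).card ≤ k * (2 * s * 2 ^ s) :=
      (Finset.card_biUnion_le_card_mul _ _ _ fun x _ => hRcard x).trans
        (Nat.mul_le_mul_right _ hF)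
    have h2 : (F ×ˢ {L + 2 - s}).card ≤ k := by simpa [Finset.card_product] using hF
    have h3 := Finset.card_union_le (B ∪ F ×ˢ {L + 2 - s}) (F.biUnion R)
    have h4 := Finset.card_union_le B (F ×ˢ {L + 2 - s})
    omega

/-! ### The recursion. -/

/-- The cardinality bound is the fixed point of m ↦ m/2 + 3k + k·2s·2^s: half of the balls survive,
k catch the far ones, k·2s·2^s replace the near ones and 2k cover the separators. A bag adds 2k
separator balls to its piece's own family. The 5k per level is k for the transfer and 2k for each
separator, covered at level 1. -/
theorem exists_rootedDecomposition [Fintype V] {G : SimpleGraph V} {r k s : ℕ} (hs : 2 ≤ s)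
    (hks : 4 * k ≤ 2 ^ s) (hG : HasCoverableSeparators G (r : ℝ) k) (d : ℕ) :
    ∀ (W : Finset V) (U : Finset (V × ℕ)), W.card < 2 ^ d →
      outerBoundary G W ⊆ scaledUnion G r U →
      U.card ≤ 2 * (3 * k + k * (2 * s * 2 ^ s)) →
      ∃ (N : Type u) (_ : Finite N) (T : RootedDecomposition G (W : Set V) (outerBoundary G W) N),
        ∀ x, ∃ U' : Finset (V × ℕ), T.bag x ⊆ scaledUnion G r U' ∧
          U'.card ≤ 2 * (3 * k + k * (2 * s * 2 ^ s)) + 2 * k ∧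
          potential U' ≤ potential U + 5 * k * (d + 1) := by
  classical
  induction d with
  | zero =>
    intro W U hW hcov hcard
    obtain rfl : W = ∅ := Finset.card_eq_zero.1 (by simpa using hW)
    rw [Finset.coe_empty] at hcov ⊢
    exact ⟨_, inferInstance, .single G _, fun _ =>
      ⟨U, hcov, hcard.trans (Nat.le_add_right _ _), Nat.le_add_right _ _⟩⟩
  | succ d ih =>
    intro W U hW hcov hcard
    obtain ⟨X₁, F₁, hF₁, hX₁, hhalf₁⟩ := hG.exists_halving U Prod.fst
    obtain ⟨X₂, F₂, hF₂, hX₂, hhalf₂⟩ := hG.exists_halving W id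
    set X : Set V := W ∩ (X₁ ∪ X₂) with hX
    let D : (G.induce ((W : Set V) \ X)).ConnectedComponent → Finset V :=
      fun C => (Subtype.val '' C.supp).toFinset
    have hD : ∀ C, (D C : Set V) = Subtype.val '' C.supp := fun C => Set.coe_toFinset _
    have hDW : ∀ C, ∀ v ∈ D C, v ∈ W ∧ v ∉ X₁ ∧ v ∉ X₂ := by
      intro C v hv
      obtain ⟨x, -, rfl⟩ := Set.mem_toFinset.1 hv
      exact ⟨x.2.1, fun h => x.2.2 ⟨x.2.1, Or.inl h⟩, fun h => x.2.2 ⟨x.2.1, Or.inr h⟩⟩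
    have hpot₁ : potential (F₁ ×ˢ {1}) ≤ 2 * k := by
      rw [potential_product_singleton]; omega
    have hpot₂ : potential (F₂ ×ˢ {1}) ≤ 2 * k := by
      rw [potential_product_singleton]; omega
    have hc₁ : (F₁ ×ˢ ({1} : Finset ℕ)).card ≤ k := by simpa [Finset.card_product] using hF₁
    have hc₂ : (F₂ ×ˢ ({1} : Finset ℕ)).card ≤ k := by simpa [Finset.card_product] using hF₂
    have hbd : ∀ C, outerBoundary G (D C : Set V) ⊆ outerBoundary G W ∪ X := by
      rintro C v ⟨hv, u, hu, huv⟩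
      by_cases hvX : v ∈ X
      · exact Or.inr hvX
      refine Or.inl ⟨fun hvW => hv ?_, u, (hDW C u hu).1, huv.symm.symm⟩
      rw [hD] at hu ⊢
      exact mem_component_of_adj hu ⟨hvW, hvX⟩ huv
    have hchild : ∀ C, ∃ U' : Finset (V × ℕ), outerBoundary G (D C : Set V) ⊆ scaledUnion G r U' ∧
        U'.card ≤ 2 * (3 * k + k * (2 * s * 2 ^ s)) ∧ potential U' ≤ potential U + 5 * k := by
      intro C
      obtain ⟨C₁, hC₁⟩ := component_subset_of_subset
        (show (W : Set V) \ X ⊆ X₁ᶜ from fun v hv h => hv.2 ⟨hv.1, Or.inl h⟩) C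
      -- The separators get their own balls; the remaining boundary is adjacent to the child and
      -- avoids `X₁`, so it lies in `C₁`.
      obtain ⟨B, hBU, hBC, U', hcov', hpot', hcard'⟩ := exists_family_of_component hs hks hF₁ hX₁
        C₁ (A := outerBoundary G (D C : Set V) \ (X₁ ∪ X₂)) (by
          rintro v ⟨⟨-, u, hu, huv⟩, hvX⟩
          rw [hD] at hu
          exact mem_component_of_adj (hC₁ hu) (fun h => hvX (Or.inl h)) huv) U (by
          rintro v ⟨hv, hvX⟩
          exact hcov ((hbd C hv).resolve_right fun h => hvX h.2))
      have hB := hhalf₁ C₁ B hBU hBC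
      refine ⟨(U' ∪ F₁ ×ˢ {1}) ∪ F₂ ×ˢ {1}, ?_, ?_, ?_⟩
      · intro v hv
        by_cases h₁ : v ∈ X₁
        · exact scaledUnion_mono (Finset.subset_union_right.trans Finset.subset_union_left)
            (hX₁ h₁)
        by_cases h₂ : v ∈ X₂
        · exact scaledUnion_mono Finset.subset_union_right (hX₂ h₂)
        exact scaledUnion_mono (Finset.subset_union_left.trans Finset.subset_union_left)
          (hcov' ⟨hv, fun h => h.elim h₁ h₂⟩)
      · have h3 := Finset.card_union_le (U' ∪ F₁ ×ˢ {1}) (F₂ ×ˢ {1})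
        have h4 := Finset.card_union_le U' (F₁ ×ˢ {1})
        omega
      · have h3 := potential_union_le (U' ∪ F₁ ×ˢ {1}) (F₂ ×ˢ {1})
        have h4 := potential_union_le U' (F₁ ×ˢ {1})
        omega
    choose U' hcov' hcard' hpot' using hchild
    have hsmall : ∀ C, (D C).card < 2 ^ d := by
      intro C
      obtain ⟨C₂, hC₂⟩ := component_subset_of_subset
        (show (W : Set V) \ X ⊆ X₂ᶜ from fun v hv h => hv.2 ⟨hv.1, Or.inr h⟩) C
      have := hhalf₂ C₂ (D C) (fun v hv => (hDW C v hv).1)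
        fun v hv => hC₂ (Set.mem_toFinset.1 hv)
      rw [pow_succ] at hW
      omega
    choose N hN T hT using fun C => ih (D C) (U' C) (hsmall C) (hcov' C) (hcard' C)
    have hdisj : Disjoint (W : Set V) (outerBoundary G W) :=
      Set.disjoint_left.2 fun v hv h => h.1 hv
    refine ⟨_, inferInstance, RootedDecomposition.glue T (X := X) Set.inter_subset_left hdisj
      ?_ ?_ ?_ hbd, ?_⟩
    · ext v
      simp only [Set.mem_iUnion, hD]
      constructor
      · intro hv
        exact ⟨(G.induce _).connectedComponentMk ⟨v, hv⟩, ⟨v, hv⟩, rfl, rfl⟩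
      · rintro ⟨C, x, -, rfl⟩
        exact x.2
    · intro C C' v hv hv'
      rw [hD] at hv hv'
      obtain ⟨x, hx, rfl⟩ := hv
      obtain ⟨y, hy, hxy⟩ := hv'
      obtain rfl := Subtype.ext hxy
      exact hx.symm.trans hy
    · intro u hu v huv
      by_cases hv : v ∈ (W : Set V)
      · exact Or.inl hv
      · exact Or.inr ⟨hv, u, hu, huv⟩
    · rintro (_ | ⟨C, x⟩)
      · refine ⟨(U ∪ F₁ ×ˢ {1}) ∪ F₂ ×ˢ {1}, ?_, ?_, ?_⟩
        · rintro v (hv | ⟨-, hv | hv⟩)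
          · exact scaledUnion_mono (Finset.subset_union_left.trans Finset.subset_union_left)
              (hcov hv)
          · exact scaledUnion_mono (Finset.subset_union_right.trans Finset.subset_union_left)
              (hX₁ hv)
          · exact scaledUnion_mono Finset.subset_union_right (hX₂ hv)
        · have h3 := Finset.card_union_le (U ∪ F₁ ×ˢ {1}) (F₂ ×ˢ {1})
          have h4 := Finset.card_union_le U (F₁ ×ˢ {1})
          omega
        · have h3 := potential_union_le (U ∪ F₁ ×ˢ {1}) (F₂ ×ˢ {1})
          have h4 := potential_union_le U (F₁ ×ˢ {1})
          have h5 : 4 * k ≤ 5 * k * (d + 1 + 1) := by nlinarith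
          omega
      · obtain ⟨U'', h1, h2, h3⟩ := hT C x
        refine ⟨U'', h1, h2, h3.trans ?_⟩
        have := hpot' C
        have h5 : 5 * k * (d + 1 + 1) = 5 * k + 5 * k * (d + 1) := by ring
        omega

/-! ### Numerical bounds and conclusion. -/

theorem coverable_of_subset_scaledUnion {G : SimpleGraph V} {r : ℕ} {U : Finset (V × ℕ)}
    {A : Set V} {K R : ℝ} (hA : A ⊆ scaledUnion G r U) (hK : (U.card : ℝ) ≤ K)
    (hR : ∀ p ∈ U, (p.2 : ℝ) ≤ R) : Coverable G K (r * R) A := by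
  classical
  refine ⟨U.image Prod.fst, le_trans (by exact_mod_cast Finset.card_image_le) hK, ?_⟩
  intro v hv
  obtain ⟨p, hp, hr, hd⟩ := mem_scaledUnion.1 (hA hv)
  refine Set.mem_iUnion₂.2 ⟨p.1, Finset.mem_image_of_mem _ hp, hr, ?_⟩
  calc (G.dist p.1 v : ℝ) ≤ r * p.2 := by exact_mod_cast hd
    _ ≤ r * R := mul_le_mul_of_nonneg_left (hR p hp) (Nat.cast_nonneg _)

/-- The expression is 8k + 4k·s·2^s; with s ≤ 4 log k and 2^s ≤ 8k this gives 8 + 4·4·8 = 136. -/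
theorem card_bound {k : ℕ} (hk : 2 ≤ k) {s : ℕ} (hs : s = Nat.clog 2 k + 2) :
    ((2 * (3 * k + k * (2 * s * 2 ^ s)) + 2 * k : ℕ) : ℝ) ≤
      136 * (k : ℝ) ^ 2 * Real.logb 2 k := by
  have hk' : (2 : ℝ) ≤ k := by exact_mod_cast hk
  have hlog : 1 ≤ Real.logb 2 (k : ℝ) := by
    rw [Real.le_logb_iff_rpow_le (by norm_num) (by linarith)]
    simpa using hk'
  have hpred : 2 ^ (Nat.clog 2 k - 1) < k := Nat.pow_pred_clog_lt_self (by norm_num) (by omega)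
  have hpos : 0 < Nat.clog 2 k := Nat.clog_pos (by norm_num) hk
  have h1 : ((Nat.clog 2 k - 1 : ℕ) : ℝ) ≤ Real.logb 2 k := by
    rw [Real.le_logb_iff_rpow_le (by norm_num) (by linarith), Real.rpow_natCast]
    exact_mod_cast hpred.le
  rw [Nat.cast_sub hpos, Nat.cast_one] at h1
  have h2 : (s : ℝ) ≤ 4 * Real.logb 2 k := by
    rw [hs]; push_cast; linarith
  have h3 : (2 : ℝ) ^ s ≤ 8 * k := by
    have : 2 ^ s = 8 * 2 ^ (Nat.clog 2 k - 1) := by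
      rw [hs, show Nat.clog 2 k + 2 = 3 + (Nat.clog 2 k - 1) by omega, pow_add]; rfl
    exact_mod_cast this.le.trans (Nat.mul_le_mul_left 8 hpred.le)
  have h4 : (s : ℝ) * 2 ^ s ≤ 4 * Real.logb 2 k * (8 * k) :=
    mul_le_mul h2 h3 (by positivity) (by linarith)
  have h5 : (k : ℝ) ≤ k ^ 2 * Real.logb 2 k := by nlinarith
  push_cast
  have h6 := mul_le_mul_of_nonneg_left h4 (by linarith : (0 : ℝ) ≤ 4 * k)
  nlinarith

/-- Since log n ≥ 1, the right side of `hl` is at most 16·k·log n, so an additive 4 would do; 136 is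
the constant shared with `card_bound`. -/
theorem level_bound {k n l : ℕ} (hk : 2 ≤ k) (hn : 2 ≤ n)
    (hl : 2 ^ l ≤ 5 * k * (Nat.log 2 n + 1 + 1)) :
    (l : ℝ) ≤ Real.logb 2 k + Real.logb 2 (Real.logb 2 n) + 136 := by
  have hk' : (2 : ℝ) ≤ k := by exact_mod_cast hk
  have hn' : (2 : ℝ) ≤ n := by exact_mod_cast hn
  have hlog : 1 ≤ Real.logb 2 (n : ℝ) := by
    rw [Real.le_logb_iff_rpow_le (by norm_num) (by linarith)]
    simpa using hn'
  have h1 : ((Nat.log 2 n : ℕ) : ℝ) ≤ Real.logb 2 n := by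
    rw [Real.le_logb_iff_rpow_le (by norm_num) (by linarith), Real.rpow_natCast]
    exact_mod_cast Nat.pow_log_le_self 2 (by omega)
  have h2 : (2 : ℝ) ^ l ≤ 5 * k * (Nat.log 2 n + 1 + 1) := by exact_mod_cast hl
  have h3 : (2 : ℝ) ^ (l : ℝ) ≤ k * Real.logb 2 n * 2 ^ (4 : ℝ) := by
    rw [Real.rpow_natCast]
    norm_num
    nlinarith
  have h4 := (Real.le_logb_iff_rpow_le (b := 2) (by norm_num) (by positivity)).2 h3
  rw [Real.logb_mul (by positivity) (by positivity), Real.logb_mul (by positivity) (by positivity),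
    Real.logb_rpow (by norm_num) (by norm_num)] at h4
  linarith

end CoarseGraph

theorem theorem1p4 :
    ∃ c : ℕ, ∀ (V : Type u) [Fintype V] (G : SimpleGraph V) (n r k : ℕ),
      Fintype.card V = n → 2 ≤ n → 1 ≤ r → 2 ≤ k →
      CoarseGraph.balancedSeparatorNumber G (r : ℝ) ≤ k →
      ∃ (N : Type u) (_ : Finite N) (T : CoarseGraph.TreeDecomposition G N),
        ∀ x : N, CoarseGraph.Coverable G
          ((c : ℝ) * (k : ℝ) ^ 2 * Real.logb 2 (k : ℝ))
          ((r : ℝ) * (Real.logb 2 (k : ℝ) + Real.logb 2 (Real.logb 2 (n : ℝ)) + (c : ℝ)))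
          (T.bag x) := by
  refine ⟨136, fun V _ G n r k hcard hn _ hk hsep => ?_⟩
  have hG := (CoarseGraph.balancedSeparatorNumber_le_iff G (Nat.cast_nonneg r) k).1 hsep
  have hks : 4 * k ≤ 2 ^ (Nat.clog 2 k + 2) := by
    rw [pow_add]
    have := Nat.le_pow_clog (b := 2) (by norm_num) k
    omega
  have hbd : CoarseGraph.outerBoundary G ((Finset.univ : Finset V) : Set V) = ∅ :=
    Set.eq_empty_of_forall_notMem fun v hv => hv.1 (by simp)
  -- The whole vertex set has empty boundary, so the recursion starts from the empty family, of
  -- potential 0.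
  obtain ⟨N, hN, T, hT⟩ := CoarseGraph.exists_rootedDecomposition (by omega) hks hG
    (Nat.log 2 n + 1) Finset.univ ∅
    (by rw [Finset.card_univ, hcard]; exact Nat.lt_pow_succ_log_self (by norm_num) n)
    (by rw [hbd]; exact Set.empty_subset _) (by simp)
  refine ⟨N, hN, T.toTreeDecomposition (by simp), fun x => ?_⟩
  obtain ⟨U, hU, hUcard, hUpot⟩ := hT x
  refine CoarseGraph.coverable_of_subset_scaledUnion hU ?_ fun p hp => ?_
  · exact (Nat.cast_le.2 hUcard).trans (CoarseGraph.card_bound hk rfl)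
  · refine CoarseGraph.level_bound hk hn
      ((CoarseGraph.two_pow_le_potential hp).trans (hUpot.trans ?_))
    simp [CoarseGraph.potential]
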